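/- For $n\ge 1$ and $u:\{-n,\dots,n\}\to\mathbb R$ put $(u*f)(k)=\sum_{\ell=-n}^{n}u(\ell)f(k-\ell)$ for $f:\mathbb Z\to\mathbb R$, let $(\Delta f)(k)=f(k+2)-2f(k+1)+f(k)$ be the discrete Laplacian, and set $$C_2(u)=\sup_{0\ne f\in\ell^2(\mathbb Z)}\frac{\|\Delta(u*f)\|_{\ell^2}}{\|f\|_{\ell^2}}.$$ Call $u$ normalized if $\sum_{\ell=-n}^{n}u(\ell)=1$. Let $E_n(k)=\frac{3(n^2-k^2)}{n(4n^2-1)}$ for $-n\le k\le n$ be the discrete Epanechnikov kernel, and let $$\mu=\max_{\alpha\in[0,16]}\left|\frac{\sin\alpha}{\alpha}-\cos\alpha\right|,$$ where $\frac{\sin\alpha}{\alpha}$ is read as $1$ at $\alpha=0$. Then, as $n\to\infty$, $$C_2(E_n)\sim\frac{3\mu}{\pi}\cdot\frac{\pi}{n^2}.$$ Here $\frac{3\mu}{\pi}\approx 1.015$, that is, $\left|\frac{3\mu}{\pi}-1.015\right|<0.0005$. Moreover, $E_n$ is within $2\%$ of the optimum for large $n$: there is $N$ such that for all $n\ge N$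 and all normalized $u:\{-n,\dots,n\}\to\mathbb R$, $C_2(E_n)<1.02\,C_2(u)$. -/

import Mathlib

open Filter Asymptotics

noncomputable section

namespace Epanechnikov

/-- The convolution `(u ∗ f)(k) = ∑_{ℓ = -n}^{n} u(ℓ) f(k - ℓ)` of a kernel supported on
`{-n, …, n}` with a function on `ℤ`. Only the values of `u` on `{-n, …, n}` are used. -/
def conv (n : ℕ) (u : ℤ → ℝ) (f : ℤ → ℝ) (k : ℤ) : ℝ :=
  ∑ l ∈ Finset.Icc (-(n : ℤ)) (n : ℤ), u l * f (k - l)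

/-- The discrete Laplacian `(Δ f)(k) = f(k+2) - 2 f(k+1) + f(k)`. -/
def laplacian (f : ℤ → ℝ) (k : ℤ) : ℝ :=
  f (k + 2) - 2 * f (k + 1) + f k

/-- The kernel is normalized: `∑_{ℓ = -n}^{n} u(ℓ) = 1`. -/
def IsNormalized (n : ℕ) (u : ℤ → ℝ) : Prop :=
  ∑ l ∈ Finset.Icc (-(n : ℤ)) (n : ℤ), u l = 1

/-- The discrete Epanechnikov kernel `E_n(k) = 3 (n² - k²) / (n (4 n² - 1))`. -/
def kernel (n : ℕ) (k : ℤ) : ℝ :=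
  3 / ((n : ℝ) * (4 * (n : ℝ) ^ 2 - 1)) * ((n : ℝ) ^ 2 - (k : ℝ) ^ 2)

theorem memlp_shift {f : ℤ → ℝ} (hf : Memℓp f 2) (c : ℤ) :
    Memℓp (fun k => f (k + c)) 2 := by
  have h2 : 0 < (2 : ENNReal).toReal := by norm_num
  rw [memℓp_gen_iff h2] at hf ⊢
  exact hf.comp_injective (Equiv.addRight c).injective

theorem memlp_conv (n : ℕ) (u : ℤ → ℝ) {f : ℤ → ℝ} (hf : Memℓp f 2) :
    Memℓp (conv n u f) 2 := by
  have h : Memℓp (fun k => ∑ l ∈ Finset.Icc (-(n : ℤ)) (n : ℤ), u l * f (k + -l)) 2 :=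
    Memℓp.finsetSum _ fun l _ => (memlp_shift hf (-l)).const_mul (u l)
  exact h

theorem memlp_laplacian {f : ℤ → ℝ} (hf : Memℓp f 2) : Memℓp (laplacian f) 2 :=
  ((memlp_shift hf 2).sub ((memlp_shift hf 1).const_mul 2)).add hf

/-- The map `f ↦ Δ(u ∗ f)` on real `ℓ²(ℤ)`. -/
def smoothing (n : ℕ) (u : ℤ → ℝ) (f : lp (fun _ : ℤ => ℝ) 2) : lp (fun _ : ℤ => ℝ) 2 :=
  ⟨laplacian (conv n u f), memlp_laplacian (memlp_conv n u (lp.memℓp f))⟩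

/-- `sup_{0 ≠ f ∈ ℓ²(ℤ)} ‖Δ(u ∗ f)‖ / ‖f‖`, a supremum of a non-empty set of real numbers that
is bounded above (see `bddAbove_smoothing`). -/
def smoothingConst (n : ℕ) (u : ℤ → ℝ) : ℝ :=
  ⨆ f : {f : lp (fun _ : ℤ => ℝ) 2 // f ≠ 0}, ‖smoothing n u f.1‖ / ‖f.1‖

/-- The shift of an element of `ℓ²(ℤ)`. -/
def shift (c : ℤ) (f : lp (fun _ : ℤ => ℝ) 2) : lp (fun _ : ℤ => ℝ) 2 :=
  ⟨fun k => f (k + c), memlp_shift (lp.memℓp f) c⟩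

theorem norm_shift (c : ℤ) (f : lp (fun _ : ℤ => ℝ) 2) : ‖shift c f‖ = ‖f‖ := by
  have h2 : 0 < (2 : ENNReal).toReal := by norm_num
  rw [lp.norm_eq_tsum_rpow h2, lp.norm_eq_tsum_rpow h2]
  congr 1
  exact (Equiv.addRight c).tsum_eq (fun k => ‖f k‖ ^ (2 : ENNReal).toReal)

theorem norm_smoothing_le (n : ℕ) (u : ℤ → ℝ) (f : lp (fun _ : ℤ => ℝ) 2) :
    ‖smoothing n u f‖ ≤ 4 * (∑ l ∈ Finset.Icc (-(n : ℤ)) (n : ℤ), |u l|) * ‖f‖ := by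
  set g : lp (fun _ : ℤ => ℝ) 2 :=
    ∑ l ∈ Finset.Icc (-(n : ℤ)) (n : ℤ), u l • shift (-l) f with hg
  have hgc : ∀ k, g k = conv n u f k := by
    intro k
    rw [hg, lp.coeFn_sum, Finset.sum_apply]
    rfl
  have hs : smoothing n u f = shift 2 g - (2 : ℝ) • shift 1 g + g := by
    ext k
    change laplacian (conv n u f) k = g (k + 2) - 2 * g (k + 1) + g k
    simp only [hgc, laplacian]
  have hgn : ‖g‖ ≤ (∑ l ∈ Finset.Icc (-(n : ℤ)) (n : ℤ), |u l|) * ‖f‖ := by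
    rw [Finset.sum_mul]
    refine (norm_sum_le _ _).trans (Finset.sum_le_sum fun l _ => ?_)
    rw [norm_smul, norm_shift, Real.norm_eq_abs]
  have h1 : ‖smoothing n u f‖ ≤ ‖shift 2 g‖ + ‖(2 : ℝ) • shift 1 g‖ + ‖g‖ := by
    rw [hs]
    exact (norm_add_le _ _).trans (add_le_add_left (norm_sub_le _ _) _)
  rw [norm_smul, norm_shift, norm_shift, Real.norm_eq_abs, abs_two] at h1
  linarith

theorem bddAbove_smoothing (n : ℕ) (u : ℤ → ℝ) :
    BddAbove (Set.range fun f : {f : lp (fun _ : ℤ => ℝ) 2 // f ≠ 0} =>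
      ‖smoothing n u f.1‖ / ‖f.1‖) := by
  refine ⟨4 * ∑ l ∈ Finset.Icc (-(n : ℤ)) (n : ℤ), |u l|, ?_⟩
  rintro _ ⟨f, rfl⟩
  exact (div_le_iff₀ (norm_pos_iff.2 f.2)).2 (norm_smoothing_le n u f.1)

/-- `μ = max_{α ∈ [0,16]} |sin α / α - cos α|`, where `sin α / α` is read as `1` at `α = 0`
(this is `Real.sinc`). The supremum is attained, see `isGreatest_mu`. -/
def mu : ℝ :=
  sSup ((fun a : ℝ => |Real.sinc a - Real.cos a|) '' Set.Icc 0 16)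

theorem isGreatest_mu :
    IsGreatest ((fun a : ℝ => |Real.sinc a - Real.cos a|) '' Set.Icc 0 16) mu := by
  refine (isCompact_Icc.image ?_).isGreatest_sSup ?_
  · exact (Real.continuous_sinc.sub Real.continuous_cos).abs
  · exact ⟨_, Set.mem_image_of_mem _ (Set.left_mem_Icc.2 (by norm_num))⟩

end Epanechnikov

end

/-! On the Fourier side `f ↦ Δ(u ∗ f)` is multiplication by a symbol of modulus `2 (1 - cos θ) |∑
u(ℓ) e^{iℓθ}|`, and `C₂(u)` is the maximum of that modulus (`norm_symbol_le`,
`norm_le_of_norm_symbol_le`). With `x = cos θ`, the real part of the exponential sum is a polynomial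
`p(x)` of degree at most `n`, and normalization reads `p(1) = 1`. So `max |2 (1 - x) p(x)|` over
`[-1,1]` bounds `C₂(u)` from below, with equality for even `u`.

Lower bound for all `u`: interpolation at Chebyshev nodes (`two_mul_sin_div_le_of_abs_eval_le`)
gives a bound asymptotic to `π / n²`.

Epanechnikov kernel: summing in closed form (`sum_parabola_cos`), the symbol at `θ = 2h` is `6 / (n
(2n + 1))` times a profile that is within `2h` of `sinc α - cos α`, `α = (2n - 1) h`. Large `α`
cannot beat `μ`, so `n² C₂(E_n) → 3μ`. The enclosure `1.0625 ≤ μ ≤ 1.0634` gives `3μ < 1.02 π`, and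
comparing the two limits yields the 2% claim. -/

noncomputable section

namespace Epanechnikov

/-! ### Extremal lower bound for polynomials via Chebyshev nodes. -/

section ChebyshevBound

open Polynomial Polynomial.Chebyshev Finset

/-- The nodes decrease and all lie below `c`, so the only negative factors of the basis polynomial
are the `i - 1` with `j < i`. -/
theorem basis_eval_mul_neg_one_pow_pos {N i : ℕ} (hi : i ∈ Icc 1 N) {c : ℝ}
    (hc : node N 1 < c) :
    0 < (-1 : ℝ) ^ (i + 1) * (Lagrange.basis (Icc 1 N) (node N) i).eval c := by
  obtain ⟨hi1, hiN⟩ := mem_Icc.1 hi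
  have hlt : ∀ j ∈ Icc 1 N, node N j < c := fun j hj => by
    obtain ⟨hj1, hjN⟩ := mem_Icc.1 hj
    rcases hj1.eq_or_lt with rfl | h
    · exact hc
    · exact (node_lt hjN h).trans hc
  have hsplit : (Icc 1 N).erase i = Ico 1 i ∪ Ioc i N := by grind
  have hdisj : Disjoint (Ico 1 i) (Ioc i N) := by grind [Finset.disjoint_iff_ne]
  have heval : ∀ j, (Lagrange.basisDivisor (node N i) (node N j)).eval c =
      (node N i - node N j)⁻¹ * (c - node N j) := fun j => by
    simp [Lagrange.basisDivisor]
  rw [Lagrange.basis, eval_prod, hsplit, prod_union hdisj]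
  have h1 : 0 < ∏ j ∈ Ico 1 i,
      (-1) * (Lagrange.basisDivisor (node N i) (node N j)).eval c := by
    refine prod_pos fun j hj => ?_
    obtain ⟨hj1, hji⟩ := mem_Ico.1 hj
    rw [heval, ← mul_assoc, neg_one_mul, ← inv_neg, neg_sub]
    exact mul_pos (inv_pos.2 (sub_pos.2 (node_lt hiN hji)))
      (sub_pos.2 (hlt j (mem_Icc.2 ⟨hj1, by omega⟩)))
  have h2 : 0 < ∏ j ∈ Ioc i N, (Lagrange.basisDivisor (node N i) (node N j)).eval c := by
    refine prod_pos fun j hj => ?_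
    obtain ⟨hij, hjN⟩ := mem_Ioc.1 hj
    rw [heval]
    exact mul_pos (inv_pos.2 (sub_pos.2 (node_lt hjN hij)))
      (sub_pos.2 (hlt j (mem_Icc.2 ⟨by omega, hjN⟩)))
  rw [prod_mul_distrib, prod_const, Nat.card_Ico] at h1
  have hpow : (-1 : ℝ) ^ (i + 1) = (-1) ^ (i - 1) := by
    obtain ⟨k, rfl⟩ := Nat.exists_eq_add_of_le' hi1
    rw [Nat.add_sub_cancel, add_assoc, pow_add]
    norm_num
  rw [hpow, ← mul_assoc]
  exact mul_pos h1 h2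

theorem eval_eq_sum_node {N : ℕ} {P : ℝ[X]} (hP : P.degree < N) (c : ℝ) :
    P.eval c = ∑ i ∈ Icc 1 N,
      P.eval (node N i) * (Lagrange.basis (Icc 1 N) (node N) i).eval c := by
  have hinj : Set.InjOn (node N) (Icc 1 N : Finset ℕ) :=
    ((strictAntiOn_node N).mono (by intro j; simp)).injOn
  conv_lhs => rw [Lagrange.eq_interpolate (f := P) hinj (by simpa using hP)]
  simp [Lagrange.interpolate_apply, eval_finsetSum]

/-- Here `c = cos (π / (2N))` is the largest zero of `T_N`, and `R = T_N / (X - c)` is extremal: `(c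
- x) R(x)` is `±1` at the nodes, with exactly the signs of the Lagrange basis at `c`. Interpolating
both polynomials gives `|P(c)| ≤ M R(c)`, where `R(c) = T_N'(c) = N U_{N-1}(c) = N / sin (π /
(2N))`. Omitting node `0` leaves `N` nodes, enough for degree below `N`. -/
theorem sin_div_mul_abs_eval_le {N : ℕ} (hN : N ≠ 0) {P : ℝ[X]} (hP : P.degree < N) {M : ℝ}
    (hM : ∀ i ∈ Icc 1 N,
      |(Real.cos (Real.pi / (2 * N)) - node N i) * P.eval (node N i)| ≤ M) :
    Real.sin (Real.pi / (2 * N)) / N * |P.eval (Real.cos (Real.pi / (2 * N)))| ≤ M := by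
  set φ : ℝ := Real.pi / (2 * N) with hφ
  set c : ℝ := Real.cos φ with hc
  have hN0 : (0 : ℝ) < N := by positivity
  have hN1 : (1 : ℝ) ≤ N := by exact_mod_cast Nat.one_le_iff_ne_zero.2 hN
  have hφ0 : 0 < φ := by positivity
  have hNφ : N * φ = Real.pi / 2 := by rw [hφ]; field_simp
  have hφpi : 2 * φ ≤ Real.pi := by nlinarith
  have hsin : 0 < Real.sin φ := Real.sin_pos_of_pos_of_lt_pi hφ0 (by linarith)
  have hnode : node N 1 < c := by
    rw [node, hc]
    have : ((1 : ℕ) : ℝ) * Real.pi / N = 2 * φ := by rw [hφ]; push_cast; field_simp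
    rw [this]
    exact Real.cos_lt_cos_of_nonneg_of_le_pi hφ0.le hφpi (by linarith)
  have hlt : ∀ j ∈ Icc 1 N, node N j < c := fun j hj => by
    obtain ⟨hj1, hjN⟩ := mem_Icc.1 hj
    rcases hj1.eq_or_lt with rfl | h
    · exact hnode
    · exact (node_lt hjN h).trans hnode
  have hroot : (T ℝ N).IsRoot c := by
    rw [IsRoot.def, hc, T_real_cos]
    push_cast
    rw [hNφ, Real.cos_pi_div_two]
  obtain ⟨R, hR⟩ := dvd_iff_isRoot.2 hroot
  have hRdeg : R.degree < N := by
    have h := congrArg degree hR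
    rw [degree_T, degree_mul, degree_X_sub_C, Int.natAbs_natCast] at h
    have hR0 : R ≠ 0 := by
      rintro rfl
      simp at h
    rw [degree_eq_natDegree hR0] at h ⊢
    have h' : N = 1 + R.natDegree := by exact_mod_cast h
    exact_mod_cast (by omega : R.natDegree < N)
  have hRc : R.eval c = N / Real.sin φ := by
    have h := congrArg (fun p => (derivative p).eval c) hR
    simp only [T_derivative_eq_U, derivative_mul, eval_add, eval_mul, derivative_sub,
      derivative_X, derivative_C, eval_sub, eval_X, eval_C, sub_self, zero_mul,
      sub_zero, one_mul, add_zero] at h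
    have hU := U_real_cos φ (N - 1)
    push_cast at hU
    rw [sub_add_cancel, hNφ, Real.sin_pi_div_two] at hU
    rw [← h, eq_div_iff hsin.ne', mul_assoc, hU]
    simp
  have hRnode : ∀ i ∈ Icc 1 N,
      R.eval (node N i) = (-1) ^ (i + 1) / (c - node N i) := fun i hi => by
    have h := congrArg (fun p => p.eval (node N i)) hR
    simp only [eval_mul, eval_sub, eval_X, eval_C] at h
    rw [eval_T_real_node (mem_Iic.2 (mem_Icc.1 hi).2)] at h
    rw [eq_div_iff (sub_pos.2 (hlt i hi)).ne', pow_succ, h]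
    ring
  have hsum : |P.eval c| ≤ M * R.eval c := by
    rw [eval_eq_sum_node hP c, eval_eq_sum_node hRdeg c, mul_sum]
    refine (abs_sum_le_sum_abs _ _).trans (sum_le_sum fun i hi => ?_)
    have hb := basis_eval_mul_neg_one_pow_pos hi hnode
    have hd := sub_pos.2 (hlt i hi)
    have hPi : |P.eval (node N i)| ≤ M / (c - node N i) := by
      rw [le_div_iff₀ hd, mul_comm]
      simpa [abs_mul, abs_of_pos hd] using hM i hi
    set b := (Lagrange.basis (Icc 1 N) (node N) i).eval c
    have hab : |b| = (-1) ^ (i + 1) * b := by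
      rw [← abs_of_pos hb, abs_mul, abs_neg_one_pow, one_mul]
    rw [hRnode i hi, abs_mul, hab]
    calc _ ≤ M / (c - node N i) * ((-1) ^ (i + 1) * b) :=
          mul_le_mul_of_nonneg_right hPi hb.le
      _ = _ := by ring
  rw [hRc] at hsum
  calc _ ≤ Real.sin φ / N * (M * (N / Real.sin φ)) := by gcongr
    _ = M := by field_simp

/-- A polynomial `p` of degree at most `n` with `p(1) = 1` satisfies
`max_{[-1,1]} |2 (1 - x) p(x)| ≥ 2 sin(π / (2 (n + 1))) / (n + 1)`; the extremal polynomials come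
from stretched Chebyshev polynomials. -/
theorem two_mul_sin_div_le_of_abs_eval_le {n : ℕ} {p : ℝ[X]} (hp : p.degree ≤ n)
    (h1 : p.eval 1 = 1) {M : ℝ} (hM : ∀ x ∈ Set.Icc (-1 : ℝ) 1, |2 * (1 - x) * p.eval x| ≤ M) :
    2 * Real.sin (Real.pi / (2 * (n + 1 : ℕ))) / (n + 1 : ℕ) ≤ M := by
  set φ : ℝ := Real.pi / (2 * (n + 1 : ℕ)) with hφ
  set c : ℝ := Real.cos φ with hc
  have hφ0 : 0 < φ := by positivity
  have hφpi : φ ≤ Real.pi / 2 := by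
    rw [hφ]
    gcongr
    push_cast
    linarith [(Nat.cast_nonneg n : (0 : ℝ) ≤ n)]
  have hc0 : 0 ≤ c := Real.cos_nonneg_of_neg_pi_div_two_le_of_le (by linarith) hφpi
  have hc1 : c ≤ 1 := Real.cos_le_one _
  -- The affine map `y ↦ s y + (s - 1)` fixes `-1` and sends `c` to `1`, so `1 - x` becomes `s (c -
  -- y)`.
  set s : ℝ := 2 / (1 + c) with hs
  have hs0 : 0 < s := by positivity
  have hsc : s * (1 + c) = 2 := by rw [hs]; field_simp
  set P : ℝ[X] := p.comp (C s * X + C (s - 1)) with hPdef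
  have hPeval : ∀ y, P.eval y = p.eval (s * y + (s - 1)) := fun y => by simp [hPdef]
  have hPdeg : P.degree < (n + 1 : ℕ) := by
    refine lt_of_le_of_lt (b := (n : WithBot ℕ)) ?_ (by exact_mod_cast Nat.lt_succ_self n)
    refine natDegree_le_iff_degree_le.1 ?_
    refine natDegree_comp_le.trans ?_
    calc p.natDegree * (C s * X + C (s - 1)).natDegree ≤ n * 1 :=
          Nat.mul_le_mul (natDegree_le_iff_degree_le.2 hp) natDegree_linear_le
      _ = n := mul_one n
  have hM0 : 0 ≤ M := (abs_nonneg _).trans (hM 1 (by simp))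
  have key := sin_div_mul_abs_eval_le (Nat.succ_ne_zero n) hPdeg (M := M / 2) ?_
  · rw [hPeval] at key
    have : s * c + (s - 1) = 1 := by linarith
    rw [← hφ, ← hc, this, h1, abs_one, mul_one] at key
    rw [mul_div_assoc]
    linarith
  · intro i hi
    have hi1 := (mem_Icc.1 hi).1
    have hnc : node (n + 1) i ≤ c := by
      have h1 : node (n + 1) i ≤ node (n + 1) 1 := by
        rcases hi1.eq_or_lt with rfl | h
        · exact le_rfl
        · exact (node_lt (mem_Icc.1 hi).2 h).le
      refine h1.trans ?_
      rw [node, hc]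
      have : ((1 : ℕ) : ℝ) * Real.pi / (n + 1 : ℕ) = 2 * φ := by
        rw [hφ]; push_cast; field_simp
      rw [this]
      exact Real.cos_le_cos_of_nonneg_of_le_pi hφ0.le (by linarith) (by linarith)
    have hnl : -1 ≤ node (n + 1) i := Real.neg_one_le_cos _
    change |(c - node (n + 1) i) * _| ≤ _
    set y := node (n + 1) i
    have hx := hM (s * y + (s - 1)) ⟨by nlinarith, by nlinarith⟩
    rw [hPeval]
    have he : 2 * (1 - (s * y + (s - 1))) * p.eval (s * y + (s - 1)) =
        2 * s * ((c - y) * p.eval (s * y + (s - 1))) := by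
      linear_combination (-2 * p.eval (s * y + (s - 1))) * hsc
    rw [he, abs_mul, abs_of_pos (by positivity)] at hx
    -- Discarding the factor `s ≥ 1` costs nothing to leading order, since `s → 1`.
    have hs1 : 1 ≤ s := by
      rw [hs, one_le_div (by linarith)]
      linarith
    nlinarith [abs_nonneg ((c - y) * p.eval (s * y + (s - 1)))]

end ChebyshevBound

/-! ### Numerical enclosure of `μ`. -/

section ProfileMaximum

theorem cos_le_quartic {x : ℝ} (hx0 : 0 ≤ x) (hx : x ≤ 2) :
    Real.cos x ≤ 1 - x ^ 2 / 2 + x ^ 4 / 24 := by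
  have h := Real.sin_ge_sub_cube (div_nonneg hx0 zero_le_two)
  have hc := Real.sin_sq_eq_half_sub (x / 2)
  rw [mul_div_cancel₀ x two_ne_zero] at hc
  have h0 : 0 ≤ x / 2 - (x / 2) ^ 3 / 6 := by
    have : x ^ 2 ≤ 4 := by nlinarith
    nlinarith
  have h2 := pow_le_pow_left₀ h0 h 2
  nlinarith [pow_nonneg hx0 6]

theorem sin_le_quintic {x : ℝ} (hx0 : 0 ≤ x) (hx : x ≤ 2) :
    Real.sin x ≤ x - x ^ 3 / 6 + x ^ 5 / 120 := by
  have hd : ∀ y : ℝ, HasDerivAt (fun y : ℝ => y - y ^ 3 / 6 + y ^ 5 / 120 - Real.sin y)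
      (1 - y ^ 2 / 2 + y ^ 4 / 24 - Real.cos y) y := fun y => by
    refine (((((hasDerivAt_id y).sub ((hasDerivAt_pow 3 y).div_const 6)).add
      ((hasDerivAt_pow 5 y).div_const 120)).sub (Real.hasDerivAt_sin y))).congr_deriv ?_
    norm_num
    ring
  have hm : MonotoneOn (fun y : ℝ => y - y ^ 3 / 6 + y ^ 5 / 120 - Real.sin y) (Set.Icc 0 2) := by
    refine monotoneOn_of_deriv_nonneg (convex_Icc _ _)
      (fun y _ => (hd y).continuousAt.continuousWithinAt)
      (fun y _ => (hd y).differentiableAt.differentiableWithinAt) fun y hy => ?_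
    rw [interior_Icc] at hy
    rw [(hd y).deriv]
    linarith [cos_le_quartic hy.1.le hy.2.le]
  have := hm ⟨le_rfl, by norm_num⟩ ⟨hx0, hx⟩ hx0
  simp at this
  linarith

theorem sinc_sub_cos_pi_sub {t : ℝ} (ht : t < Real.pi) :
    Real.sinc (Real.pi - t) - Real.cos (Real.pi - t) =
      Real.sin t / (Real.pi - t) + Real.cos t := by
  rw [Real.sinc_of_ne_zero (sub_pos.2 ht).ne', Real.sin_pi_sub, Real.cos_pi_sub, sub_neg_eq_add]

/-- Up to `π/2` both terms lie in `[0,1]`. Beyond `π`, Cauchy–Schwarz gives the bound `√(1 + a⁻²)`.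
In between, put `a = π - t` and use Taylor bounds in `t`. The constant must be this sharp: `3μ/π <
1.0155` needs `μ` below about `1.06343`. -/
theorem abs_sinc_sub_cos_le {a : ℝ} (ha : 0 ≤ a) : |Real.sinc a - Real.cos a| ≤ 1.0634 := by
  have hpi := Real.pi_gt_d6
  have hpi' := Real.pi_lt_d6
  rcases le_total a (Real.pi / 2) with h | h
  · have hc := Real.cos_nonneg_of_neg_pi_div_two_le_of_le (by linarith) h
    have hc' := Real.cos_le_one a
    have hs : 0 ≤ Real.sinc a := by
      rw [Real.sinc_apply]
      split_ifs
      · exact zero_le_one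
      · exact div_nonneg (Real.sin_nonneg_of_nonneg_of_le_pi ha (by linarith)) ha
    have hs' := Real.sinc_le_one a
    rw [abs_le]
    constructor <;> linarith
  have ha0 : 0 < a := by linarith
  rcases lt_or_ge Real.pi a with h' | h'
  · rw [Real.sinc_of_ne_zero ha0.ne']
    refine abs_le_of_sq_le_sq ?_ (by norm_num)
    have hinv : a⁻¹ ≤ 0.32 := by
      rw [inv_le_comm₀ ha0 (by norm_num)]
      norm_num
      linarith
    have hinv0 : 0 < a⁻¹ := by positivity
    have hsq := Real.sin_sq_add_cos_sq a
    have hcs : (Real.sin a * a⁻¹ - Real.cos a) ^ 2 ≤ 1 + a⁻¹ ^ 2 := by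
      have : (Real.sin a * a⁻¹ - Real.cos a) ^ 2 + (Real.sin a + Real.cos a * a⁻¹) ^ 2 =
          (Real.sin a ^ 2 + Real.cos a ^ 2) * (1 + a⁻¹ ^ 2) := by ring
      rw [hsq] at this
      nlinarith [sq_nonneg (Real.sin a + Real.cos a * a⁻¹)]
    rw [div_eq_mul_inv]
    nlinarith
  · obtain ⟨t, rfl⟩ : ∃ t, a = Real.pi - t := ⟨Real.pi - a, by ring⟩
    have ht0 : 0 ≤ t := by linarith
    have ht1 : t ≤ 1.58 := by linarith
    have hc := Real.cos_nonneg_of_neg_pi_div_two_le_of_le (x := t) (by linarith) (by linarith)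
    have hs := Real.sin_nonneg_of_nonneg_of_le_pi ht0 (by linarith)
    rw [sinc_sub_cos_pi_sub (by linarith), abs_of_nonneg (by positivity)]
    have hc4 := cos_le_quartic ht0 (by linarith)
    have hs5 := sin_le_quintic ht0 (by linarith)
    rw [div_add' _ _ _ ha0.ne', div_le_iff₀ ha0]
    have hmul := mul_le_mul_of_nonneg_right hc4 ha
    -- This is the inequality left by the Taylor bounds, with `π` lowered to `3.1415`. It is nearly
    -- tight around `t = 0.4`, close to the maximizer, hence the weights `(t - 0.4)²`.
    have hpoly : 0 ≤ 3.1415 * (0.0634 + t ^ 2 / 2 - t ^ 4 / 24) - 1.0634 * t - t ^ 3 / 3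
        + t ^ 5 / 30 := by
      have hw := sq_nonneg (t - 0.4)
      have h1 := sub_nonneg.2 ht1
      nlinarith [mul_nonneg ht0 hw, mul_nonneg (mul_nonneg ht0 h1) hw, mul_nonneg h1 hw,
        mul_nonneg (mul_nonneg (sq_nonneg t) h1) hw, mul_nonneg (mul_nonneg (sq_nonneg t) ht0) hw,
        mul_nonneg (sq_nonneg t) hw]
    have hq : 0 ≤ 0.0634 + t ^ 2 / 2 - t ^ 4 / 24 := by
      have : t ^ 2 ≤ 3 := by nlinarith
      nlinarith [sq_nonneg t]
    nlinarith

theorem mu_le : mu ≤ 1.0634 := by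
  obtain ⟨⟨a, ha, h⟩, -⟩ := isGreatest_mu
  rw [← h]
  exact abs_sinc_sub_cos_le ha.1

theorem le_mu : 1.0625 ≤ mu := by
  have hpi := Real.pi_gt_d6
  have hpi' := Real.pi_lt_d6
  refine le_trans ?_ (isGreatest_mu.2 (Set.mem_image_of_mem _
    (⟨by linarith, by linarith⟩ : Real.pi - 0.4 ∈ Set.Icc (0 : ℝ) 16)))
  refine le_trans ?_ (le_abs_self _)
  rw [sinc_sub_cos_pi_sub (by linarith)]
  have hs := Real.sin_ge_sub_cube (x := 0.4) (by norm_num)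
  -- Doubling the angle: `2 · 0.98² - 1 = 0.9208`.
  have hc : 0.9208 ≤ Real.cos 0.4 := by
    have h2 := Real.one_sub_sq_div_two_le_cos (x := 0.2)
    have h := Real.cos_two_mul 0.2
    norm_num at h h2 ⊢
    nlinarith
  have hd : 0.1417 ≤ Real.sin 0.4 / (Real.pi - 0.4) := by
    rw [le_div_iff₀ (by linarith)]
    norm_num at hs ⊢
    linarith
  linarith

/-- Past `16` the trivial bound `1 + 1/16 = 1.0625` is already at most `μ`, so the maximum over
`[0,16]` is global on the half-line. -/
theorem abs_sinc_sub_cos_le_mu {a : ℝ} (ha : 0 ≤ a) : |Real.sinc a - Real.cos a| ≤ mu := by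
  rcases le_total a 16 with h | h
  · exact isGreatest_mu.2 (Set.mem_image_of_mem _ ⟨ha, h⟩)
  · refine le_trans ?_ le_mu
    have ha0 : 0 < a := by linarith
    have hs : |Real.sinc a| ≤ 1 / 16 := by
      rw [Real.sinc_of_ne_zero ha0.ne', abs_div, abs_of_pos ha0]
      exact div_le_div₀ zero_le_one (Real.abs_sin_le_one a) (by norm_num) h
    calc _ ≤ |Real.sinc a| + |Real.cos a| := abs_sub _ _
      _ ≤ 1 / 16 + 1 := add_le_add hs (Real.abs_cos_le_one a)
      _ = _ := by norm_num

theorem abs_three_mul_mu_div_pi_sub_lt : |3 * mu / Real.pi - 1.015| < 0.0005 := by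
  have h1 := Real.pi_gt_d6
  have h2 := Real.pi_lt_d6
  have h3 := mu_le
  have h4 := le_mu
  rw [abs_lt, neg_lt_sub_iff_lt_add, sub_lt_iff_lt_add, div_lt_iff₀ Real.pi_pos,
    ← sub_lt_iff_lt_add', lt_div_iff₀ Real.pi_pos]
  constructor <;> norm_num at * <;> linarith

end ProfileMaximum

/-! ### Operator norm of a finite combination of translations on `ℓ²(ℤ)`. -/

section FourierMultiplier

open MeasureTheory AddCircle

theorem norm_sq_eq_tsum {E : Type*} [NormedAddCommGroup E] (f : lp (fun _ : ℤ => E) 2) :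
    ‖f‖ ^ 2 = ∑' k, ‖f k‖ ^ 2 := by
  have h := lp.norm_rpow_eq_tsum (p := 2) (by norm_num) f
  simpa using h

theorem sum_sq_le_norm_sq (f : lp (fun _ : ℤ => ℝ) 2) (s : Finset ℤ) :
    ∑ k ∈ s, f k ^ 2 ≤ ‖f‖ ^ 2 := by
  have h := lp.sum_rpow_le_norm_rpow (p := 2) (by norm_num) f s
  simpa using h

/-- A function on `ℤ` cut off outside a finite set, as an element of `ℓ²(ℤ)`. -/
def truncate (s : Finset ℤ) (a : ℤ → ℝ) : lp (fun _ : ℤ => ℝ) 2 :=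
  ⟨fun k => if k ∈ s then a k else 0, by
    refine memℓp_gen (summable_of_ne_finset_zero (s := s) fun k hk => ?_)
    simp [hk]⟩

theorem truncate_apply_of_mem {s : Finset ℤ} (a : ℤ → ℝ) {k : ℤ} (hk : k ∈ s) :
    truncate s a k = a k :=
  if_pos hk

theorem norm_sq_truncate (s : Finset ℤ) (a : ℤ → ℝ) :
    ‖truncate s a‖ ^ 2 = ∑ k ∈ s, a k ^ 2 := by
  rw [norm_sq_eq_tsum, tsum_eq_sum (s := s) fun k hk => ?_]
  · refine Finset.sum_congr rfl fun k hk => ?_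
    rw [truncate_apply_of_mem a hk, Real.norm_eq_abs, sq_abs]
  · have : truncate s a k = 0 := if_neg hk
    simp [this]

section Multiplier

variable {ι : Type*} (s : Finset ι) (c : ι → ℝ) (d : ι → ℤ)

/-- The symbol `∑ cᵢ e^{i dᵢ θ}` of the finite combination of translations
`f ↦ ∑ cᵢ f(· - dᵢ)`. -/
def symbol (θ : ℝ) : ℂ :=
  ∑ i ∈ s, (c i : ℂ) * Complex.exp (((d i : ℝ) * θ : ℝ) * Complex.I)

variable {s c d} {A : lp (fun _ : ℤ => ℝ) 2 → lp (fun _ : ℤ => ℝ) 2}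

/-- Test on the wave `e^{ikθ}` cut off to `|k| ≤ L + D`, split into cosine and sine since the space
is real. Where `|k| ≤ L` the cutoff is invisible and the operator multiplies the wave by the
conjugate symbol. Comparing `2L + 1` with `2(L + D) + 1` as `L` grows gives the claim. -/
theorem norm_symbol_le (hA : ∀ f k, A f k = ∑ i ∈ s, c i * f (k - d i)) {K : ℝ} (hK : 0 ≤ K)
    (hbound : ∀ f, ‖A f‖ ≤ K * ‖f‖) (θ : ℝ) : ‖symbol s c d θ‖ ≤ K := by
  obtain ⟨D, hD⟩ : ∃ D : ℕ, ∀ i ∈ s, (d i).natAbs ≤ D :=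
    ⟨s.sup fun i => (d i).natAbs, fun i hi => Finset.le_sup (f := fun i => (d i).natAbs) hi⟩
  have key : ∀ L : ℕ, ((2 * L + 1 : ℕ) : ℝ) * ‖symbol s c d θ‖ ^ 2 ≤
      K ^ 2 * (2 * (L + D) + 1 : ℕ) := fun L => by
    set S : Finset ℤ := Finset.Icc (-((L + D : ℕ) : ℤ)) ((L + D : ℕ) : ℤ) with hS
    set f := truncate S fun k => Real.cos (k * θ) with hf
    set g := truncate S fun k => Real.sin (k * θ) with hg
    have hcardS : S.card = 2 * (L + D) + 1 := by rw [hS, Int.card_Icc]; omega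
    have hfg : ‖f‖ ^ 2 + ‖g‖ ^ 2 = (2 * (L + D) + 1 : ℕ) := by
      rw [hf, hg, norm_sq_truncate, norm_sq_truncate, ← Finset.sum_add_distrib,
        Finset.sum_congr rfl fun (k : ℤ) _ => Real.cos_sq_add_sin_sq ((k : ℝ) * θ),
        Finset.sum_const, hcardS]
      simp
    have hval : ∀ k ∈ Finset.Icc (-(L : ℤ)) (L : ℤ),
        A f k ^ 2 + A g k ^ 2 = ‖symbol s c d θ‖ ^ 2 := fun k hk => by
      obtain ⟨hk1, hk2⟩ := Finset.mem_Icc.1 hk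
      have hmem : ∀ i ∈ s, k - d i ∈ S := fun i hi => by
        have := hD i hi
        rw [hS, Finset.mem_Icc]
        omega
      have hz : (A f k : ℂ) + (A g k : ℂ) * Complex.I =
          Complex.exp ((k * θ : ℝ) * Complex.I) * (starRingEnd ℂ) (symbol s c d θ) := by
        rw [hA, hA, symbol, map_sum, Finset.mul_sum]
        push_cast
        rw [Finset.sum_mul, ← Finset.sum_add_distrib]
        refine Finset.sum_congr rfl fun i hi => ?_
        rw [hf, hg, truncate_apply_of_mem _ (hmem i hi), truncate_apply_of_mem _ (hmem i hi),
          map_mul, Complex.conj_ofReal, ← Complex.exp_conj, map_mul, Complex.conj_I]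
        rw [show ∀ a b x : ℂ, a * (x * b) = x * (a * b) by intros; ring, ← Complex.exp_add]
        rw [mul_assoc, ← mul_add, Complex.ofReal_cos, Complex.ofReal_sin, ← Complex.exp_mul_I]
        congr 2
        simp only [map_mul, Complex.conj_ofReal]
        push_cast
        simp
        ring
      have hn := congrArg (fun z : ℂ => ‖z‖ ^ 2) hz
      simp only [norm_mul, Complex.norm_exp_ofReal_mul_I, one_mul, Complex.norm_conj] at hn
      rw [← hn, Complex.sq_norm, Complex.normSq_add_mul_I]
    have h1 : ∑ k ∈ Finset.Icc (-(L : ℤ)) (L : ℤ), (A f k ^ 2 + A g k ^ 2) ≤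
        ‖A f‖ ^ 2 + ‖A g‖ ^ 2 := by
      rw [Finset.sum_add_distrib]
      exact add_le_add (sum_sq_le_norm_sq _ _) (sum_sq_le_norm_sq _ _)
    rw [Finset.sum_congr rfl hval, Finset.sum_const, nsmul_eq_mul, Int.card_Icc] at h1
    have hcard : ((L : ℤ) + 1 - -(L : ℤ)).toNat = 2 * L + 1 := by omega
    rw [hcard] at h1
    have h2 := pow_le_pow_left₀ (norm_nonneg _) (hbound f) 2
    have h3 := pow_le_pow_left₀ (norm_nonneg _) (hbound g) 2
    rw [mul_pow] at h2 h3
    rw [← hfg]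
    linarith
  refine (sq_le_sq₀ (norm_nonneg _) hK).1 ?_
  by_contra! hlt
  obtain ⟨L, hL⟩ := exists_nat_gt (K ^ 2 * (2 * D) / (‖symbol s c d θ‖ ^ 2 - K ^ 2))
  rw [div_lt_iff₀ (sub_pos.2 hlt)] at hL
  have := key L
  push_cast at this
  nlinarith

/-- Complexification `ℓ²(ℤ, ℝ) → ℓ²(ℤ, ℂ)`. -/
def complexify (f : lp (fun _ : ℤ => ℝ) 2) : lp (fun _ : ℤ => ℂ) 2 :=
  ⟨fun k => (f k : ℂ), by
    have h := (memℓp_gen_iff (p := 2) (by norm_num)).1 (lp.memℓp f)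
    refine memℓp_gen ?_
    simpa using h⟩

theorem norm_complexify (f : lp (fun _ : ℤ => ℝ) 2) : ‖complexify f‖ = ‖f‖ := by
  rw [← sq_eq_sq₀ (norm_nonneg _) (norm_nonneg _), norm_sq_eq_tsum, norm_sq_eq_tsum]
  exact tsum_congr fun k => by rw [show complexify f k = (f k : ℂ) from rfl, Complex.norm_real]

theorem fourierCoeff_fourier_mul {T : ℝ} [Fact (0 < T)] (j k : ℤ) (F : AddCircle T → ℂ) :
    fourierCoeff (fun x => fourier j x * F x) k = fourierCoeff F (k - j) := by
  refine integral_congr_ae (Eventually.of_forall fun x => ?_)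
  simp only [smul_eq_mul]
  rw [← mul_assoc, ← fourier_add, neg_sub, neg_add_eq_sub]

/-- By Parseval, `f` is the coefficient sequence of some `F` in `L²` of the circle, and `A` becomes
multiplication of `F` by the symbol, which is bounded by `K`. -/
theorem norm_le_of_norm_symbol_le (hA : ∀ f k, A f k = ∑ i ∈ s, c i * f (k - d i)) {K : ℝ}
    (hK : ∀ θ, ‖symbol s c d θ‖ ≤ K) (f : lp (fun _ : ℤ => ℝ) 2) : ‖A f‖ ≤ K * ‖f‖ := by
  have : Fact (0 < 2 * Real.pi) := ⟨Real.two_pi_pos⟩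
  set F : Lp ℂ 2 (haarAddCircle (T := 2 * Real.pi)) := fourierBasis.repr.symm (complexify f)
    with hF
  set m : C(AddCircle (2 * Real.pi), ℂ) := ∑ i ∈ s, (c i : ℂ) • fourier (d i) with hm
  have hmK : ∀ x, ‖m x‖ ≤ K := fun x => by
    obtain ⟨θ, rfl⟩ := QuotientAddGroup.mk_surjective x
    have : m (θ : AddCircle (2 * Real.pi)) = symbol s c d θ := by
      rw [hm, ContinuousMap.sum_apply, symbol]
      refine Finset.sum_congr rfl fun i _ => ?_
      rw [ContinuousMap.smul_apply, fourier_coe_apply, smul_eq_mul]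
      congr 2
      push_cast
      field_simp
    exact this ▸ hK θ
  have hFmem : MemLp F 2 (haarAddCircle (T := 2 * Real.pi)) := Lp.memLp F
  have hFint : Integrable F (haarAddCircle (T := 2 * Real.pi)) := hFmem.integrable one_le_two
  have hmem : MemLp (fun x => m x * F x) 2 (haarAddCircle (T := 2 * Real.pi)) :=
    hFmem.of_le_mul (m.continuous.aestronglyMeasurable.mul hFmem.1)
      (Eventually.of_forall fun x => by
        rw [norm_mul]
        exact mul_le_mul_of_nonneg_right (hmK x) (norm_nonneg _))
  have hcoef : fourierBasis.repr hmem.toLp = complexify (A f) := by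
    ext k
    have hFk : ∀ j, fourierCoeff F j = f j := fun j => by
      rw [← fourierBasis_repr, hF, LinearIsometryEquiv.apply_symm_apply]
      rfl
    rw [fourierBasis_repr]
    have h1 : fourierCoeff hmem.toLp k = fourierCoeff (fun x => m x * F x) k := by
      refine integral_congr_ae ?_
      filter_upwards [hmem.coeFn_toLp] with x hx
      rw [hx]
    have h2 : (fun x => m x * F x) =
        ∑ i ∈ s, (c i : ℂ) • fun x => fourier (d i) x * F x := by
      ext x
      simp [hm, Finset.sum_mul, mul_assoc]
    have h3 : fourierCoeff (∑ i ∈ s, (c i : ℂ) • fun x => fourier (d i) x * F x) =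
        ∑ i ∈ s, fourierCoeff ((c i : ℂ) • fun x => fourier (d i) x * F x) :=
      fourierCoeff.sum _ _ fun i _ => (hFint.fourier_smul (d i)).smul (c i : ℂ)
    change _ = ((A f k : ℝ) : ℂ)
    rw [h1, h2, h3, Finset.sum_apply, hA]
    push_cast
    refine Finset.sum_congr rfl fun i _ => ?_
    rw [fourierCoeff.const_smul, fourierCoeff_fourier_mul, hFk, smul_eq_mul]
  rw [← norm_complexify, ← norm_complexify, ← hcoef, LinearIsometryEquiv.norm_map]
  have hFn : ‖F‖ = ‖complexify f‖ := by rw [hF, LinearIsometryEquiv.norm_map]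
  rw [← hFn]
  refine Lp.norm_le_mul_norm_of_ae_le_mul ?_
  filter_upwards [hmem.coeFn_toLp] with x hx
  rw [hx, norm_mul]
  exact mul_le_mul_of_nonneg_right (hmK x) (norm_nonneg _)

end Multiplier

end FourierMultiplier

/-! ### The smoothing constant as a polynomial maximum. -/

section SmoothingSymbol

open Polynomial Polynomial.Chebyshev

/-- The exponential sum `∑_{ℓ = -n}^{n} u(ℓ) e^{iℓθ}`. -/
def expSum (n : ℕ) (u : ℤ → ℝ) (θ : ℝ) : ℂ :=
  ∑ l ∈ Finset.Icc (-(n : ℤ)) (n : ℤ), (u l : ℂ) * Complex.exp (((l : ℝ) * θ : ℝ) * Complex.I)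

/-- The polynomial `p` with `p(cos θ) = ∑_{ℓ = -n}^{n} u(ℓ) cos(ℓθ)`. -/
def cosPoly (n : ℕ) (u : ℤ → ℝ) : ℝ[X] :=
  ∑ l ∈ Finset.Icc (-(n : ℤ)) (n : ℤ), C (u l) * T ℝ l

theorem cosPoly_eval_cos (n : ℕ) (u : ℤ → ℝ) (θ : ℝ) :
    (cosPoly n u).eval (Real.cos θ) =
      ∑ l ∈ Finset.Icc (-(n : ℤ)) (n : ℤ), u l * Real.cos (l * θ) := by
  simp [cosPoly, eval_finsetSum]

theorem cosPoly_eval_one (n : ℕ) (u : ℤ → ℝ) :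
    (cosPoly n u).eval 1 = ∑ l ∈ Finset.Icc (-(n : ℤ)) (n : ℤ), u l := by
  simpa using cosPoly_eval_cos n u 0

theorem degree_cosPoly_le (n : ℕ) (u : ℤ → ℝ) : (cosPoly n u).degree ≤ n := by
  refine (degree_sum_le _ _).trans (Finset.sup_le fun l hl => ?_)
  refine degree_le_of_natDegree_le ((natDegree_C_mul_le _ _).trans ?_)
  rw [natDegree_T]
  have := Finset.mem_Icc.1 hl
  omega

theorem re_expSum (n : ℕ) (u : ℤ → ℝ) (θ : ℝ) :
    (expSum n u θ).re = (cosPoly n u).eval (Real.cos θ) := by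
  rw [cosPoly_eval_cos, expSum, Complex.re_sum]
  refine Finset.sum_congr rfl fun l _ => ?_
  rw [Complex.re_ofReal_mul, Complex.exp_ofReal_mul_I_re]

theorem im_expSum_of_even (n : ℕ) {u : ℤ → ℝ} (hu : ∀ l, u (-l) = u l) (θ : ℝ) :
    (expSum n u θ).im = 0 := by
  rw [expSum, Complex.im_sum]
  have h : ∀ l : ℤ, ((u l : ℂ) * Complex.exp (((l : ℝ) * θ : ℝ) * Complex.I)).im =
      u l * Real.sin (l * θ) := fun l => by
    rw [Complex.im_ofReal_mul, Complex.exp_ofReal_mul_I_im]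
  simp only [h]
  have hneg : ∑ l ∈ Finset.Icc (-(n : ℤ)) (n : ℤ), u l * Real.sin (l * θ) =
      ∑ l ∈ Finset.Icc (-(n : ℤ)) (n : ℤ), -(u l * Real.sin (l * θ)) := by
    refine Finset.sum_nbij' (fun l => -l) (fun l => -l) ?_ ?_ ?_ ?_ ?_
    · intro l; simp only [Finset.mem_Icc]; omega
    · intro l; simp only [Finset.mem_Icc]; omega
    · simp
    · simp
    · intro l _
      simp [hu]
  rw [Finset.sum_neg_distrib] at hneg
  linarith

/-- The indices of the translations that make up `f ↦ Δ(u ∗ f)`. -/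
def smoothingIndex (n : ℕ) : Finset (ℤ × Fin 3) :=
  Finset.Icc (-(n : ℤ)) (n : ℤ) ×ˢ Finset.univ

theorem smoothing_apply (n : ℕ) (u : ℤ → ℝ) (f : lp (fun _ : ℤ => ℝ) 2) (k : ℤ) :
    smoothing n u f k = ∑ i ∈ smoothingIndex n,
      (u i.1 * ![1, -2, 1] i.2) * f (k - (i.1 - (i.2 : ℕ))) := by
  change laplacian (conv n u f) k = _
  rw [smoothingIndex, Finset.sum_product, laplacian, conv, conv, conv, Finset.mul_sum,
    ← Finset.sum_sub_distrib, ← Finset.sum_add_distrib]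
  refine Finset.sum_congr rfl fun l _ => ?_
  rw [Fin.sum_univ_three]
  have h0 : k - (l - ((0 : Fin 3) : ℕ)) = k - l := by simp
  have h1 : k - (l - ((1 : Fin 3) : ℕ)) = k + 1 - l := by simp; ring
  have h2 : k - (l - ((2 : Fin 3) : ℕ)) = k + 2 - l := by simp; ring
  simp only [h0, h1, h2]
  simp
  ring

/-- The symbol factors as `(1 - e^{-iθ})²` times the exponential sum, and `|1 - e^{-iθ}|² = 2 (1 -
cos θ)`. -/
theorem norm_symbol_smoothing (n : ℕ) (u : ℤ → ℝ) (θ : ℝ) :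
    ‖symbol (smoothingIndex n) (fun i => u i.1 * ![1, -2, 1] i.2)
      (fun i => i.1 - (i.2 : ℕ)) θ‖ = 2 * (1 - Real.cos θ) * ‖expSum n u θ‖ := by
  set w : ℂ := Complex.exp (((-θ : ℝ) : ℂ) * Complex.I) with hw
  have h : symbol (smoothingIndex n) (fun i => u i.1 * ![1, -2, 1] i.2)
      (fun i => i.1 - (i.2 : ℕ)) θ = (1 - w) ^ 2 * expSum n u θ := by
    rw [symbol, smoothingIndex, Finset.sum_product, expSum, Finset.mul_sum]
    refine Finset.sum_congr rfl fun l _ => ?_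
    have hexp : ∀ j : Fin 3, Complex.exp ((((l - ((j : ℕ) : ℤ) : ℤ) : ℝ) * θ : ℝ) * Complex.I) =
        Complex.exp (((l : ℝ) * θ : ℝ) * Complex.I) * w ^ (j : ℕ) := fun j => by
      rw [hw, ← Complex.exp_nat_mul, ← Complex.exp_add]
      congr 1
      push_cast
      ring
    rw [Fin.sum_univ_three]
    simp only [hexp]
    simp
    ring
  have hsq : ‖1 - w‖ ^ 2 = 2 * (1 - Real.cos θ) := by
    rw [Complex.sq_norm, Complex.normSq_apply, hw, Complex.sub_re, Complex.sub_im,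
      Complex.exp_ofReal_mul_I_re, Complex.exp_ofReal_mul_I_im, Real.cos_neg, Real.sin_neg,
      Complex.one_re, Complex.one_im]
    linear_combination Real.sin_sq_add_cos_sq θ
  rw [h, norm_mul, norm_pow, hsq]

theorem norm_smoothing_le_smoothingConst (n : ℕ) (u : ℤ → ℝ) (f : lp (fun _ : ℤ => ℝ) 2) :
    ‖smoothing n u f‖ ≤ smoothingConst n u * ‖f‖ := by
  rcases eq_or_ne f 0 with rfl | hf
  · simpa using norm_smoothing_le n u 0
  · exact (div_le_iff₀ (norm_pos_iff.2 hf)).1 (le_ciSup (bddAbove_smoothing n u) ⟨f, hf⟩)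

theorem smoothingConst_nonneg (n : ℕ) (u : ℤ → ℝ) : 0 ≤ smoothingConst n u :=
  Real.iSup_nonneg fun _ => by positivity

/-- Only the real part of the exponential sum is kept, so no symmetry of `u` is needed. -/
theorem le_smoothingConst (n : ℕ) (u : ℤ → ℝ) {x : ℝ} (hx : x ∈ Set.Icc (-1 : ℝ) 1) :
    |2 * (1 - x) * (cosPoly n u).eval x| ≤ smoothingConst n u := by
  have h := norm_symbol_le (smoothing_apply n u) (smoothingConst_nonneg n u)
    (norm_smoothing_le_smoothingConst n u) (Real.arccos x)
  rw [norm_symbol_smoothing, Real.cos_arccos hx.1 hx.2] at h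
  refine le_trans ?_ h
  rw [abs_mul, abs_of_nonneg (by linarith [hx.2])]
  refine mul_le_mul_of_nonneg_left ?_ (by linarith [hx.2])
  have := re_expSum n u (Real.arccos x)
  rw [Real.cos_arccos hx.1 hx.2] at this
  rw [← this]
  exact Complex.abs_re_le_norm _

theorem smoothingConst_le_of_even (n : ℕ) {u : ℤ → ℝ} (hu : ∀ l, u (-l) = u l) {K : ℝ}
    (hK : ∀ x ∈ Set.Icc (-1 : ℝ) 1, |2 * (1 - x) * (cosPoly n u).eval x| ≤ K) :
    smoothingConst n u ≤ K := by
  have hK0 : 0 ≤ K := (abs_nonneg _).trans (hK 1 (by simp))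
  refine Real.iSup_le (fun f => div_le_of_le_mul₀ (norm_nonneg _) hK0 ?_) hK0
  refine norm_le_of_norm_symbol_le (smoothing_apply n u) (fun θ => ?_) f.1
  rw [norm_symbol_smoothing]
  have h := hK (Real.cos θ) ⟨Real.neg_one_le_cos θ, Real.cos_le_one θ⟩
  rw [abs_mul, abs_of_nonneg (by linarith [Real.cos_le_one θ]), ← re_expSum] at h
  rwa [← Complex.abs_re_eq_norm.2 (im_expSum_of_even n hu θ)]

/-- The optimal-order lower bound for normalized kernels. -/
theorem IsNormalized.le_smoothingConst {n : ℕ} {u : ℤ → ℝ} (hu : IsNormalized n u) :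
    2 * Real.sin (Real.pi / (2 * (n + 1 : ℕ))) / (n + 1 : ℕ) ≤ smoothingConst n u :=
  two_mul_sin_div_le_of_abs_eval_le (degree_cosPoly_le n u)
    ((cosPoly_eval_one n u).trans hu) fun _ hx => Epanechnikov.le_smoothingConst n u hx

end SmoothingSymbol

/-! ### Asymptotics of the Epanechnikov constant and of the lower bound. -/

section KernelAsymptotics

theorem sum_cos_mul_sin (n : ℕ) (h : ℝ) :
    (∑ l ∈ Finset.Icc (-(n : ℤ)) (n : ℤ), Real.cos (l * (2 * h))) * Real.sin h =
      Real.sin ((2 * n + 1) * h) := by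
  induction n with
  | zero => simp
  | succ n ih =>
    push_cast
    rw [Finset.sum_Icc_succ_eq_add_endpoints, add_mul, ih]
    push_cast
    rw [show -((n : ℝ) + 1) * (2 * h) = -((2 * n + 2) * h) by ring,
      show ((n : ℝ) + 1) * (2 * h) = (2 * n + 2) * h by ring, Real.cos_neg,
      show (2 * (n : ℝ) + 1) * h = (2 * n + 2) * h - h by ring,
      show (2 * ((n : ℝ) + 1) + 1) * h = (2 * n + 2) * h + h by ring, Real.sin_sub, Real.sin_add]
    ring

/-- Induction on `n`: the new endpoints have weight zero and every other weight grows by `(n+1)² -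
n² = 2n + 1`, so each step adds a multiple of the Dirichlet kernel. -/
theorem sum_parabola_cos (n : ℕ) (h : ℝ) :
    2 * Real.sin h ^ 3 *
      ∑ l ∈ Finset.Icc (-(n : ℤ)) (n : ℤ), ((n : ℝ) ^ 2 - (l : ℝ) ^ 2) * Real.cos (l * (2 * h)) =
      Real.sin ((2 * n - 1) * h) - (2 * n - 1) * Real.sin h * Real.cos (2 * n * h) := by
  induction n with
  | zero => simp
  | succ n ih =>
    have hstep : ∑ l ∈ Finset.Icc (-((n + 1 : ℕ) : ℤ)) ((n + 1 : ℕ) : ℤ),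
        (((n + 1 : ℕ) : ℝ) ^ 2 - (l : ℝ) ^ 2) * Real.cos (l * (2 * h)) =
        ∑ l ∈ Finset.Icc (-(n : ℤ)) (n : ℤ), ((n : ℝ) ^ 2 - (l : ℝ) ^ 2) * Real.cos (l * (2 * h)) +
        (2 * n + 1) * ∑ l ∈ Finset.Icc (-(n : ℤ)) (n : ℤ), Real.cos (l * (2 * h)) := by
      push_cast
      rw [Finset.sum_Icc_succ_eq_add_endpoints, Finset.mul_sum, ← Finset.sum_add_distrib]
      push_cast
      rw [neg_sq, sub_self, zero_mul, zero_mul, zero_add, zero_add]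
      exact Finset.sum_congr rfl fun l _ => by ring
    have hD := sum_cos_mul_sin n h
    rw [hstep, mul_add, ih]
    set D := ∑ l ∈ Finset.Icc (-(n : ℤ)) (n : ℤ), Real.cos (l * (2 * h))
    have e1 : Real.sin ((2 * (n : ℝ) - 1) * h) =
        Real.sin (2 * n * h) * Real.cos h - Real.cos (2 * n * h) * Real.sin h := by
      rw [← Real.sin_sub]; ring_nf
    have e2 : Real.sin ((2 * (n : ℝ) + 1) * h) =
        Real.sin (2 * n * h) * Real.cos h + Real.cos (2 * n * h) * Real.sin h := by
      rw [← Real.sin_add]; ring_nf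
    have e3 : Real.cos (2 * ((n : ℝ) + 1) * h) =
        Real.cos (2 * n * h) * (2 * Real.cos h ^ 2 - 1) -
          Real.sin (2 * n * h) * (2 * Real.sin h * Real.cos h) := by
      rw [← Real.cos_two_mul, ← Real.sin_two_mul, ← Real.cos_add]; ring_nf
    rw [e2] at hD
    push_cast
    rw [show 2 * ((n : ℝ) + 1) - 1 = 2 * n + 1 by ring, e1, e2, e3]
    linear_combination (2 * Real.sin h ^ 2 * (2 * n + 1)) * hD +
      (2 * n + 1) * 2 * Real.sin h * Real.cos (2 * n * h) * Real.sin_sq_add_cos_sq h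

theorem kernel_neg (n : ℕ) (l : ℤ) : kernel n (-l) = kernel n l := by
  simp [kernel]

/-- The rescaled multiplier of the Epanechnikov kernel. -/
def profile (n : ℕ) (h : ℝ) : ℝ :=
  Real.sin ((2 * n - 1) * h) / ((2 * n - 1) * Real.sin h) - Real.cos (2 * n * h)

theorem cosPoly_kernel_eval {n : ℕ} (hn : 1 ≤ n) {h : ℝ} (hh : Real.sin h ≠ 0) :
    2 * (1 - Real.cos (2 * h)) * (cosPoly n (kernel n)).eval (Real.cos (2 * h)) =
      6 / (n * (2 * n + 1)) * profile n h := by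
  have hn1 : (1 : ℝ) ≤ n := by exact_mod_cast hn
  have h1 : 2 * (n : ℝ) - 1 ≠ 0 := by linarith
  have h2 : (4 * (n : ℝ) ^ 2 - 1) = (2 * n - 1) * (2 * n + 1) := by ring
  have hS := sum_parabola_cos n h
  rw [cosPoly_eval_cos]
  simp only [kernel, mul_assoc (3 / ((n : ℝ) * (4 * (n : ℝ) ^ 2 - 1)))]
  rw [← Finset.mul_sum, profile, h2]
  set S := ∑ l ∈ Finset.Icc (-(n : ℤ)) (n : ℤ),
    ((n : ℝ) ^ 2 - (l : ℝ) ^ 2) * Real.cos (l * (2 * h))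
  have hcos : 1 - Real.cos (2 * h) = 2 * Real.sin h ^ 2 := by
    rw [Real.cos_two_mul, Real.cos_sq']; ring
  rw [hcos]
  field_simp
  linear_combination 6 * hS

/-- Two replacements, `sin h` by `h` and `2n h` by `(2n - 1) h`, each cost at most `h`. -/
theorem abs_profile_sub_le {n : ℕ} (hn : 1 ≤ n) {h : ℝ} (h0 : 0 < h) (hpi : h ≤ Real.pi / 2) :
    |profile n h - (Real.sinc ((2 * n - 1) * h) - Real.cos ((2 * n - 1) * h))| ≤ 2 * h := by
  have hn1 : (1 : ℝ) ≤ n := by exact_mod_cast hn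
  have hb : 0 < (2 * (n : ℝ) - 1) * h := mul_pos (by linarith) h0
  have hpi4 := Real.pi_lt_d2
  have hpi0 := Real.pi_gt_three
  have hsin := Real.mul_le_sin h0.le hpi
  have hs0 : 0 < Real.sin h := Real.sin_pos_of_pos_of_lt_pi h0 (by linarith)
  have hcube := Real.sin_ge_sub_cube h0.le
  have hratio : |h / Real.sin h - 1| ≤ h := by
    have hle := Real.sin_le h0.le
    rw [abs_of_nonneg (by rw [sub_nonneg, one_le_div hs0]; exact hle), sub_le_iff_le_add,
      div_le_iff₀ hs0]
    have h2 : 0.6 ≤ 2 / Real.pi := by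
      rw [le_div_iff₀ Real.pi_pos]; linarith
    have h3 : 0.6 * h ≤ Real.sin h := (mul_le_mul_of_nonneg_right h2 h0.le).trans hsin
    nlinarith [mul_pos h0 h0, mul_le_mul_of_nonneg_left h3 h0.le]
  have hcos : |Real.cos ((2 * n - 1) * h) - Real.cos (2 * n * h)| ≤ h := by
    refine (Real.abs_cos_sub_cos_le _ _).trans_eq ?_
    rw [show (2 * (n : ℝ) - 1) * h - 2 * n * h = -h by ring, abs_neg, abs_of_pos h0]
  have heq : profile n h - (Real.sinc ((2 * n - 1) * h) - Real.cos ((2 * n - 1) * h)) =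
      Real.sinc ((2 * n - 1) * h) * (h / Real.sin h - 1) +
        (Real.cos ((2 * n - 1) * h) - Real.cos (2 * n * h)) := by
    have h1 : 2 * (n : ℝ) - 1 ≠ 0 := by linarith
    rw [profile, Real.sinc_of_ne_zero hb.ne']
    field_simp
    ring
  rw [heq]
  calc _ ≤ |Real.sinc ((2 * n - 1) * h)| * |h / Real.sin h - 1| +
        |Real.cos ((2 * n - 1) * h) - Real.cos (2 * n * h)| := by
        rw [← abs_mul]; exact abs_add_le _ _
    _ ≤ 1 * h + h := by
        gcongr
        exact Real.abs_sinc_le_one _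
    _ = 2 * h := by ring

theorem abs_profile_le {n : ℕ} (hn : 1 ≤ n) {h : ℝ} (h0 : 0 < h) (hpi : h ≤ Real.pi / 2) :
    |profile n h| ≤ mu + 64 / (2 * n - 1) := by
  have hn1 : (1 : ℝ) ≤ n := by exact_mod_cast hn
  have h1 : 0 < 2 * (n : ℝ) - 1 := by linarith
  have hb : 0 < (2 * (n : ℝ) - 1) * h := mul_pos h1 h0
  -- Below `32` the error `2h` is at most `64 / (2n - 1)`. Above it, `sin h ≥ 2h/π` makes the
  -- quotient at most `1/20`, and `1 + 1/20` is below `μ`.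
  rcases le_total ((2 * (n : ℝ) - 1) * h) 32 with hle | hge
  · have h2 := abs_profile_sub_le hn h0 hpi
    have h3 := abs_sinc_sub_cos_le_mu hb.le
    have h4 : h ≤ 32 / (2 * n - 1) := by rw [le_div_iff₀ h1]; linarith
    have h5 := abs_sub_abs_le_abs_sub (profile n h)
      (Real.sinc ((2 * n - 1) * h) - Real.cos ((2 * n - 1) * h))
    have h6 : 64 / (2 * (n : ℝ) - 1) = 2 * (32 / (2 * n - 1)) := by ring
    rw [h6]
    linarith
  · have hsin := Real.mul_le_sin h0.le hpi
    have hpi4 := Real.pi_lt_d2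
    have hden : 20 ≤ (2 * (n : ℝ) - 1) * Real.sin h := by
      have h2 : 0.63 ≤ 2 / Real.pi := by
        rw [le_div_iff₀ Real.pi_pos]; norm_num at hpi4 ⊢; linarith
      have h3 : 0.63 * h ≤ Real.sin h := (mul_le_mul_of_nonneg_right h2 h0.le).trans hsin
      nlinarith [mul_le_mul_of_nonneg_left h3 h1.le]
    have hfrac : |Real.sin ((2 * n - 1) * h) / ((2 * n - 1) * Real.sin h)| ≤ 1 / 20 := by
      rw [abs_div, abs_of_pos (by linarith : 0 < (2 * (n : ℝ) - 1) * Real.sin h)]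
      exact div_le_div₀ zero_le_one (Real.abs_sin_le_one _) (by norm_num) hden
    have hpos : 0 ≤ 64 / (2 * (n : ℝ) - 1) := by positivity
    have hmu := le_mu
    calc |profile n h| ≤ 1 / 20 + 1 :=
          (abs_sub _ _).trans (add_le_add hfrac (Real.abs_cos_le_one _))
      _ ≤ _ := by norm_num at hmu ⊢; linarith

theorem smoothingConst_kernel_le {n : ℕ} (hn : 1 ≤ n) :
    smoothingConst n (kernel n) ≤ 6 / (n * (2 * n + 1)) * (mu + 64 / (2 * n - 1)) := by
  have hn1 : (1 : ℝ) ≤ n := by exact_mod_cast hn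
  have h1 : 0 < 2 * (n : ℝ) - 1 := by linarith
  have hmu : 0 < mu := lt_of_lt_of_le (by norm_num) le_mu
  refine smoothingConst_le_of_even n (kernel_neg n) fun x hx => ?_
  rcases hx.2.eq_or_lt with rfl | hx1
  · rw [sub_self, mul_zero, zero_mul, abs_zero]
    positivity
  · obtain ⟨h, rfl, h0, hpi⟩ : ∃ h, Real.cos (2 * h) = x ∧ 0 < h ∧ h ≤ Real.pi / 2 :=
      ⟨Real.arccos x / 2, by rw [mul_div_cancel₀ _ two_ne_zero, Real.cos_arccos hx.1 hx.2],
        half_pos (Real.arccos_pos.2 hx1), by linarith [Real.arccos_le_pi x]⟩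
    have hs : 0 < Real.sin h :=
      Real.sin_pos_of_pos_of_lt_pi h0 (by linarith [Real.pi_pos])
    rw [cosPoly_kernel_eval hn hs.ne', abs_mul, abs_of_pos (by positivity)]
    exact mul_le_mul_of_nonneg_left (abs_profile_le hn h0 hpi) (by positivity)

theorem le_smoothingConst_kernel {n : ℕ} (hn : 9 ≤ n) :
    6 / (n * (2 * n + 1)) * (mu - 32 / (2 * n - 1)) ≤ smoothingConst n (kernel n) := by
  have hn9 : (9 : ℝ) ≤ n := by exact_mod_cast hn
  have h1 : 0 < 2 * (n : ℝ) - 1 := by linarith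
  obtain ⟨⟨a, ha, hamu⟩, -⟩ := isGreatest_mu
  simp only at hamu
  have ha0 : 0 < a := by
    refine ha.1.lt_of_ne ?_
    rintro rfl
    have := le_mu
    rw [← hamu] at this
    norm_num at this
  set h : ℝ := a / (2 * n - 1) with hh
  have hah : (2 * (n : ℝ) - 1) * h = a := by rw [hh]; field_simp
  have h0 : 0 < h := div_pos ha0 h1
  have hle : h ≤ 16 / (2 * n - 1) := div_le_div_of_nonneg_right ha.2 h1.le
  -- This is where `n ≥ 9` enters: it keeps `h ≤ 1 < π/2`.
  have h16 : 16 / (2 * (n : ℝ) - 1) ≤ 1 := by rw [div_le_one h1]; linarith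
  have hpi := Real.pi_gt_three
  have hs : 0 < Real.sin h := Real.sin_pos_of_pos_of_lt_pi h0 (by linarith)
  have hprof := abs_profile_sub_le (n := n) (by omega) h0 (by linarith)
  rw [hah] at hprof
  have habs := abs_sub_abs_le_abs_sub (Real.sinc a - Real.cos a) (profile n h)
  rw [abs_sub_comm] at hprof
  rw [hamu] at habs
  have key := le_smoothingConst n (kernel n)
    (⟨Real.neg_one_le_cos (2 * h), Real.cos_le_one _⟩ : Real.cos (2 * h) ∈ Set.Icc (-1 : ℝ) 1)
  rw [cosPoly_kernel_eval (by omega) hs.ne', abs_mul, abs_of_pos (by positivity)] at key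
  refine le_trans (mul_le_mul_of_nonneg_left ?_ (by positivity)) key
  have h6 : 32 / (2 * (n : ℝ) - 1) = 2 * (16 / (2 * n - 1)) := by ring
  rw [h6]
  linarith

theorem tendsto_sq_mul_smoothingConst_kernel :
    Tendsto (fun n : ℕ => (n : ℝ) ^ 2 * smoothingConst n (kernel n)) atTop (nhds (3 * mu)) := by
  have hinv : Tendsto (fun n : ℕ => ((n : ℝ))⁻¹) atTop (nhds 0) :=
    tendsto_inv_atTop_nhds_zero_nat
  have hbound : ∀ b : ℝ, Tendsto (fun n : ℕ => (n : ℝ) ^ 2 *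
      (6 / (n * (2 * n + 1)) * (mu + b / (2 * n - 1)))) atTop (nhds (3 * mu)) := fun b => by
    have hlim : Tendsto (fun n : ℕ => 6 / (2 + (n : ℝ)⁻¹) *
        (mu + b * (n : ℝ)⁻¹ / (2 - (n : ℝ)⁻¹))) atTop
        (nhds (6 / (2 + 0) * (mu + b * 0 / (2 - 0)))) :=
      (tendsto_const_nhds.div (tendsto_const_nhds.add hinv) (by norm_num)).mul
        (tendsto_const_nhds.add ((tendsto_const_nhds.mul hinv).div
          (tendsto_const_nhds.sub hinv) (by norm_num)))
    have hval : 6 / (2 + 0) * (mu + b * 0 / (2 - 0)) = 3 * mu := by norm_num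
    rw [hval] at hlim
    refine hlim.congr' ?_
    filter_upwards [eventually_ge_atTop 1] with n hn
    have hn1 : (1 : ℝ) ≤ n := by exact_mod_cast hn
    have h1 : 2 * (n : ℝ) - 1 ≠ 0 := by linarith
    have h2 : 2 - (n : ℝ)⁻¹ = (2 * n - 1) / n := by field_simp
    rw [h2]
    field_simp
  refine tendsto_of_tendsto_of_tendsto_of_le_of_le' (hbound (-32)) (hbound 64) ?_ ?_
  · filter_upwards [eventually_ge_atTop 9] with n hn
    refine mul_le_mul_of_nonneg_left ?_ (sq_nonneg _)
    rw [neg_div, ← sub_eq_add_neg]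
    exact le_smoothingConst_kernel hn
  · filter_upwards [eventually_ge_atTop 1] with n hn
    exact mul_le_mul_of_nonneg_left (smoothingConst_kernel_le hn) (sq_nonneg _)

theorem tendsto_sq_mul_lower_bound :
    Tendsto (fun n : ℕ => (n : ℝ) ^ 2 *
      (2 * Real.sin (Real.pi / (2 * (n + 1 : ℕ))) / (n + 1 : ℕ))) atTop (nhds Real.pi) := by
  have h1 : Tendsto (fun n : ℕ => (n : ℝ) / (n + 1)) atTop (nhds 1) :=
    tendsto_natCast_div_add_atTop 1
  have h2 : Tendsto (fun n : ℕ => Real.pi / 2 * (1 / ((n : ℝ) + 1))) atTop (nhds 0) := by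
    simpa using tendsto_one_div_add_atTop_nhds_zero_nat.const_mul (Real.pi / 2)
  have h3 := ((h1.pow 2).mul_const Real.pi).mul ((Real.continuous_sinc.tendsto 0).comp h2)
  rw [Real.sinc_zero, one_pow, one_mul, mul_one] at h3
  refine h3.congr fun n => ?_
  have hpos : Real.pi / 2 * (1 / ((n : ℝ) + 1)) ≠ 0 := by positivity
  have harg : Real.pi / (2 * (n + 1 : ℕ)) = Real.pi / 2 * (1 / ((n : ℝ) + 1)) := by
    push_cast
    field_simp
  rw [harg, Function.comp_apply, Real.sinc_of_ne_zero hpos]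
  push_cast
  field_simp

end KernelAsymptotics

end Epanechnikov

end

theorem theorem2 :
    ((fun n : ℕ => Epanechnikov.smoothingConst n (Epanechnikov.kernel n)) ~[atTop]
      (fun n : ℕ => 3 * Epanechnikov.mu / Real.pi * (Real.pi / (n : ℝ) ^ 2))) ∧
    |3 * Epanechnikov.mu / Real.pi - 1.015| < 0.0005 ∧
    (∀ᶠ n : ℕ in atTop, ∀ u : ℤ → ℝ, Epanechnikov.IsNormalized n u →
      Epanechnikov.smoothingConst n (Epanechnikov.kernel n) <
        1.02 * Epanechnikov.smoothingConst n u) := by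
  have hmu : 0 < Epanechnikov.mu := lt_of_lt_of_le (by norm_num) Epanechnikov.le_mu
  have hnum := Epanechnikov.abs_three_mul_mu_div_pi_sub_lt
  have hlim := Epanechnikov.tendsto_sq_mul_smoothingConst_kernel
  refine ⟨?_, hnum, ?_⟩
  · refine (isEquivalent_iff_tendsto_one ?_).2 ?_
    · filter_upwards [eventually_ge_atTop 1] with n hn
      have : (n : ℝ) ≠ 0 := by positivity
      positivity
    · have h := hlim.div_const (3 * Epanechnikov.mu)
      rw [div_self (by positivity)] at h
      refine h.congr' ?_
      filter_upwards [eventually_ge_atTop 1] with n hn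
      have : (n : ℝ) ≠ 0 := by positivity
      rw [Pi.div_apply]
      field_simp
  · have hlt : 3 * Epanechnikov.mu < 1.02 * Real.pi := by
      have := (abs_lt.1 hnum).2
      rw [sub_lt_iff_lt_add, div_lt_iff₀ Real.pi_pos] at this
      refine this.trans (mul_lt_mul_of_pos_right ?_ Real.pi_pos)
      norm_num
    filter_upwards [hlim.eventually_lt (Epanechnikov.tendsto_sq_mul_lower_bound.const_mul 1.02) hlt,
      eventually_ge_atTop 1] with n hn hn1 u hu
    have hn0 : (0 : ℝ) < (n : ℝ) ^ 2 := by positivity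
    rw [mul_left_comm] at hn
    exact (lt_of_mul_lt_mul_left hn hn0.le).trans_le
      (mul_le_mul_of_nonneg_left hu.le_smoothingConst (by norm_num))
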